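/- Let $G$ be a Carnot group, i.e. a connected, simply connected Lie group whose Lie algebra $\mathfrak g$ of left-invariant vector fields has a stratification $\mathfrak g=\mathfrak g_1\oplus\cdots\oplus\mathfrak g_s$: $s\ge 1$, $[\mathfrak g_1,\mathfrak g_i]=\mathfrak g_{i+1}$ for $1\le i\le s$, $\mathfrak g_s\neq\{0\}$ and $\mathfrak g_i=\{0\}$ for $i>s$. Let $\mu$ be a Haar measure on $G$. For $X\in\mathfrak g_1\setminus\{0\}$ and $x\in G$ let $t\mapsto\Phi_X(x,t)=x\cdot\exp(tX)$ be the integral curve of $X$ starting at $x$; a line is a set of the form $\Phi_X(x,\mathbb R)$. A set $\mathcal A$ of lines is null if it is null for the smooth measures with positive density on the manifold of lines (the quotient of $(\mathfrak g_1\setminus\{0\})\times G$ by the submersion $(X,x)\mapsto\Phi_X(x,\mathbb R)$), i.e. if $\{(X,x)\in(\mathfrak g_1\setminus\{0\})\times G:\ \Phi_X(x,\mathbb R)\in\mathcal A\}$ is null for the product of Lebesgue measure on $\mathfrak g_1$ and $\mu$. A line $L=\Phi_X(x,\mathbb R)$ is monotone for $E\subset G$ if $t\mapsto\mathbb 1_E(\Phi_X(x,t))$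 agrees Lebesgue-a.e. with a monotone (nondecreasing or nonincreasing) function on $\mathbb R$; equivalently, up to a null set $\{t:\Phi_X(x,t)\in E\}$ is empty, $\mathbb R$, or a half-line. A set $E\subset G$ is monotone if it is $\mu$-measurable and the set of lines that are not monotone for $E$ is null. Theorem. Every monotone set $E\subset G$ has locally finite perimeter: $E$ is $\mu$-measurable and for every $X\in\mathfrak g_1$ the distribution $X\mathbb 1_E:\varphi\mapsto-\int_E X\varphi\,d\mu$, $\varphi\in C_c^\infty(G)$, is a (signed) Radon measure, i.e. there are Radon measures $\nu_1,\nu_2$ on $G$ with $-\int_E X\varphi\,d\mu=\int\varphi\,d\nu_1-\int\varphi\,d\nu_2$ for all $\varphi\in C_c^\infty(G)$. -/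

import Mathlib

open Set MeasureTheory
open scoped Manifold ContDiff

noncomputable section

namespace CarnotGroup

/-- A stratification `L = V₁ ⊕ ⋯ ⊕ Vₛ` of a real Lie algebra: `[V₁, Vᵢ] = Vᵢ₊₁` for
`1 ≤ i ≤ s`, `Vₛ ≠ 0` and `Vᵢ = 0` for `i > s`. The layers are indexed by all natural numbers;
those with index outside `{1, …, s}` are zero. -/
structure Stratification (L : Type*) [LieRing L] [LieAlgebra ℝ L] where
  /-- the step `s` -/
  step : ℕ
  /-- the layers `Vᵢ` -/
  layer : ℕ → Submodule ℝ L
  one_le_step : 1 ≤ step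
  layer_zero : layer 0 = ⊥
  layer_step_ne_bot : layer step ≠ ⊥
  layer_of_step_lt : ∀ i, step < i → layer i = ⊥
  isInternal : DirectSum.IsInternal layer
  span_bracket : ∀ i, 1 ≤ i → i ≤ step →
    Submodule.span ℝ {Z : L | ∃ X ∈ layer 1, ∃ Y ∈ layer i, ⁅X, Y⁆ = Z} = layer (i + 1)

/-- A smooth Lie group is smooth enough for its Lie algebra of left-invariant vector fields. -/
instance instLieGroupMinSmoothness {V : Type*} [NormedAddCommGroup V] [NormedSpace ℝ V]
    {G : Type*} [TopologicalSpace G] [ChartedSpace V G] [Group G] [LieGroup 𝓘(ℝ, V) ∞ G] :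
    LieGroup 𝓘(ℝ, V) (minSmoothness ℝ 3) G :=
  LieGroup.of_le (n := ∞) (by simp only [minSmoothness_of_isRCLikeNormedField]; exact ENat.LEInfty.out)

variable {V : Type*} [NormedAddCommGroup V] [NormedSpace ℝ V] [FiniteDimensional ℝ V]
  {G : Type*} [TopologicalSpace G] [ChartedSpace V G] [Group G] [LieGroup 𝓘(ℝ, V) ∞ G]

/-- The layers of a stratification of the Lie algebra of `G` carry their Borel `σ`-algebra. -/
instance instMeasurableSpaceLayer (S : Stratification (GroupLieAlgebra 𝓘(ℝ, V) G)) (i : ℕ) :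
    MeasurableSpace (S.layer i) := borel _

instance instBorelSpaceLayer (S : Stratification (GroupLieAlgebra 𝓘(ℝ, V) G)) (i : ℕ) :
    BorelSpace (S.layer i) := ⟨rfl⟩

instance instLocallyCompactSpaceLayer (S : Stratification (GroupLieAlgebra 𝓘(ℝ, V) G)) (i : ℕ) :
    LocallyCompactSpace (S.layer i) := by
  have h : ∀ W : Submodule ℝ V, LocallyCompactSpace W := fun W => inferInstance
  exact h (S.layer i)

instance instSecondCountableTopologyLayer (S : Stratification (GroupLieAlgebra 𝓘(ℝ, V) G))
    (i : ℕ) : SecondCountableTopology (S.layer i) := by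
  have h : ∀ W : Submodule ℝ V, SecondCountableTopology W := fun W =>
    secondCountable_of_proper
  exact h (S.layer i)

/-- `γ : ℝ → G` is an integral curve of the left-invariant vector field with value `X` at the
identity. -/
def IsFlowLine (X : GroupLieAlgebra 𝓘(ℝ, V) G) (γ : ℝ → G) : Prop :=
  IsMIntegralCurve γ (fun g : G => (mulInvariantVectorField X g : TangentSpace 𝓘(ℝ, V) g))

/-- The (horizontal) lines of `G`: the images of the integral curves of the left-invariant vector
fields in the first layer that are not zero. -/
def Line (S : Stratification (GroupLieAlgebra 𝓘(ℝ, V) G)) : Type _ :=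
  {L : Set G // ∃ X ∈ S.layer 1, X ≠ 0 ∧ ∃ γ : ℝ → G, IsFlowLine X γ ∧ range γ = L}

/-- `L` is the line through `x` with direction `X`. -/
def Line.IsThrough {S : Stratification (GroupLieAlgebra 𝓘(ℝ, V) G)} (L : Line S)
    (X : S.layer 1) (x : G) : Prop :=
  X ≠ 0 ∧ ∃ γ : ℝ → G, IsFlowLine (X : GroupLieAlgebra 𝓘(ℝ, V) G) γ ∧ γ 0 = x ∧
    range γ = L.1

/-- A line `L` is monotone for `A` if the characteristic function of `A` along `L`, read in the
time parameter of the flow, agrees almost everywhere with a monotone (that is, a nondecreasing or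
a nonincreasing) function. Any two such parametrizations of a line differ by an affine change
of the parameter. -/
def Line.IsMonotoneFor {S : Stratification (GroupLieAlgebra 𝓘(ℝ, V) G)} (L : Line S)
    (A : Set G) : Prop :=
  ∀ X ∈ S.layer 1, X ≠ 0 → ∀ γ : ℝ → G, IsFlowLine X γ → range γ = L.1 →
    ∃ f : ℝ → ℝ, (Monotone f ∨ Antitone f) ∧
      (fun t => A.indicator (fun _ => (1 : ℝ)) (γ t)) =ᵐ[volume] f

variable [MeasurableSpace G]

/-- Null sets of lines. The lines form the quotient manifold of `(𝔤₁ ∖ {0}) × G` by the map that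
sends `(X, x)` to the line through `x` with direction `X`. This map is a surjective submersion,
hence a set of lines is null for the smooth measures with positive density on the manifold of lines
exactly when its preimage is null for the product of a Lebesgue measure on `𝔤₁` and a Haar
measure `μ` on `G`. -/
def IsNullSetOfLines (S : Stratification (GroupLieAlgebra 𝓘(ℝ, V) G)) (μ : Measure G)
    (𝓐 : Set (Line S)) : Prop :=
  ((Measure.addHaar : Measure (S.layer 1)).prod μ)
    {p : S.layer 1 × G | ∃ L ∈ 𝓐, L.IsThrough p.1 p.2} = 0

/-- Monotone sets: `μ`-measurable sets for which almost every line is monotone. -/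
def IsMonotoneSet (S : Stratification (GroupLieAlgebra 𝓘(ℝ, V) G)) (μ : Measure G)
    (A : Set G) : Prop :=
  NullMeasurableSet A μ ∧ IsNullSetOfLines S μ {L : Line S | ¬ L.IsMonotoneFor A}

/-- The derivative `Xφ` of a function `φ` along the left-invariant vector field `X`. -/
def lieDeriv (X : GroupLieAlgebra 𝓘(ℝ, V) G) (φ : G → ℝ) (g : G) : ℝ :=
  (mfderiv 𝓘(ℝ, V) 𝓘(ℝ, ℝ) φ g : TangentSpace 𝓘(ℝ, V) g → ℝ) (mulInvariantVectorField X g)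

/-- The distribution `X𝟙_A`, that is `φ ↦ - ∫_A Xφ dμ` for `φ` in `C^∞_c(G)`, is a (signed) Radon
measure, that is, a difference of two locally finite Borel regular measures. -/
def DerivIsRadon (μ : Measure G) (A : Set G) (X : GroupLieAlgebra 𝓘(ℝ, V) G) : Prop :=
  ∃ ν₁ ν₂ : Measure G, ν₁.Regular ∧ ν₂.Regular ∧
    ∀ φ : G → ℝ, ContMDiff 𝓘(ℝ, V) 𝓘(ℝ, ℝ) ∞ φ → HasCompactSupport φ →
      -∫ g in A, lieDeriv X φ g ∂μ = ∫ g, φ g ∂ν₁ - ∫ g, φ g ∂ν₂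

/-- `A` has locally finite perimeter: it is `μ`-measurable and `X𝟙_A` is a Radon measure for every
`X` in the first layer. -/
def HasLocallyFinitePerimeter (S : Stratification (GroupLieAlgebra 𝓘(ℝ, V) G)) (μ : Measure G)
    (A : Set G) : Prop :=
  NullMeasurableSet A μ ∧ ∀ X ∈ S.layer 1, DerivIsRadon μ A X

end CarnotGroup

end

/-! Fix a direction `X` with one-parameter subgroup `γ`. Right translation by `γ t` multiplies Haar
measure by `exp (c * t)`, so an integral over `G` can be replaced by its average over `t` in `[0,
1]` along the curves `x * γ t`, with weight `exp (-c * t)`. If almost every such curve is monotone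
for `E`, then within `[0, 1]` it meets `E` in an interval from `a x` to `b x`, up to a null set. The
fundamental theorem of calculus turns `∫_E (Xφ - cφ)` into the integral over `x` of the difference
of `exp (-c * t) * φ (x * γ t)` between `t = b x` and `t = a x`. Both terms integrate `φ` against
images of weighted Haar measure under maps that move points for a time in `[0, 1]`, hence against
locally finite measures (`exists_setIntegral_deriv_eq`).

By Fubini, this covers almost every `X` in the first layer. The directions with Radon derivative
form a linear subspace (`exists_submodule_derivIsRadon`), and a subspace of full measure is the
whole layer (`eq_top_of_ae_mem`). -/

namespace CarnotGroup

/-! ### Monotone sets on the real line -/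

/-- A bounded order-connected set of reals is an interval up to its end points. -/
theorem exists_Ioo_subset_of_ordConnected {s : Set ℝ} (hs : s.OrdConnected)
    (h01 : s ⊆ Icc 0 1) :
    ∃ a b : ℝ, 0 ≤ a ∧ a ≤ b ∧ b ≤ 1 ∧ Ioo a b ⊆ s ∧ s ⊆ Icc a b := by
  rcases s.eq_empty_or_nonempty with rfl | hne
  · exact ⟨0, 0, le_rfl, le_rfl, zero_le_one, by simp, by simp⟩
  have hb : BddBelow s := bddBelow_Icc.mono h01
  have ha : BddAbove s := bddAbove_Icc.mono h01
  refine ⟨sInf s, sSup s, le_csInf hne fun x hx => (h01 hx).1, csInf_le_csSup hne hb ha,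
    csSup_le hne fun x hx => (h01 hx).2, fun x hx => ?_,
    fun x hx => ⟨csInf_le hb hx, le_csSup ha hx⟩⟩
  obtain ⟨y, hy, hyx⟩ := exists_lt_of_csInf_lt hne hx.1
  obtain ⟨z, hz, hxz⟩ := exists_lt_of_lt_csSup hne hx.2
  exact hs.out hy hz ⟨hyx.le, hxz.le⟩

/-- Along a monotone line, a set is an interval up to a null set. -/
theorem exists_integral_indicator_eq {s : Set ℝ} {f : ℝ → ℝ} (hf : Monotone f ∨ Antitone f)
    (h : s.indicator (fun _ => (1 : ℝ)) =ᵐ[volume] f) :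
    ∃ a b : ℝ, 0 ≤ a ∧ a ≤ b ∧ b ≤ 1 ∧ ∀ g : ℝ → ℝ,
      ∫ t in (0 : ℝ)..1, s.indicator (fun _ => (1 : ℝ)) t * g t = ∫ t in a..b, g t := by
  -- Almost everywhere `f` is 0 or 1, so any level strictly between separates the two values;
  -- superlevel sets of monotone functions are order-connected.
  have hT : OrdConnected {t | 1 / 2 < f t} := by
    rcases hf with hf | hf
    · exact ⟨fun x hx y _ z hz => lt_of_lt_of_le hx (hf hz.1)⟩
    · exact ⟨fun x _ y hy z hz => lt_of_lt_of_le hy (hf hz.2)⟩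
  obtain ⟨a, b, ha, hab, hb, h1, h2⟩ := exists_Ioo_subset_of_ordConnected
    (hT.inter (ordConnected_Icc (a := (0 : ℝ)) (b := 1))) inter_subset_right
  refine ⟨a, b, ha, hab, hb, fun g => ?_⟩
  have key : ∀ᵐ t : ℝ, (Ioc (0 : ℝ) 1).indicator
      (fun t => s.indicator (fun _ => (1 : ℝ)) t * g t) t = (Ioc a b).indicator g t := by
    filter_upwards [h, Measure.ae_ne volume a, Measure.ae_ne volume b, Measure.ae_ne volume 0]
      with t ht hta htb ht0
    by_cases hts : t ∈ s
    · have hft : f t = 1 := by rw [← ht]; simp [hts]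
      by_cases ht1 : t ∈ Ioc (0 : ℝ) 1
      · have := h2 (show t ∈ _ ∩ _ from ⟨by simp [hft]; norm_num, ht1.1.le, ht1.2⟩)
        have h3 : t ∈ Ioc a b := ⟨lt_of_le_of_ne this.1 (Ne.symm hta), this.2⟩
        simp [ht1, h3, hts]
      · have h3 : t ∉ Ioc a b := fun h3 => ht1 ⟨ha.trans_lt h3.1, h3.2.trans hb⟩
        simp [ht1, h3]
    · have hft : f t = 0 := by rw [← ht]; simp [hts]
      have h3 : t ∉ Ioc a b := fun h3 => by
        have h4 : 1 / 2 < f t := (h1 (show t ∈ Ioo a b from ⟨h3.1, lt_of_le_of_ne h3.2 htb⟩)).1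
        rw [hft] at h4
        norm_num at h4
      rw [indicator_of_notMem h3, indicator_apply]
      simp [hts]
  rw [intervalIntegral.integral_of_le zero_le_one, intervalIntegral.integral_of_le hab,
    ← integral_indicator measurableSet_Ioc, ← integral_indicator measurableSet_Ioc]
  exact integral_congr_ae key

/-- The left (`σ = -1`) or right (`σ = 1`) end point of an interval in `[0, 1]`, computed from its
length `m` and its first moment `q`, and clamped to `[0, 1]`. -/
noncomputable def endpoint (σ m q : ℝ) : ℝ := max 0 (min 1 (q / m + σ * m / 2))

theorem endpoint_mem_Icc (σ m q : ℝ) : endpoint σ m q ∈ Icc (0 : ℝ) 1 :=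
  ⟨le_max_left _ _, max_le zero_le_one (min_le_left _ _)⟩

/-- First moment over length is the midpoint, and half the length on either side of it gives the
ends. The clamping matters only for curves that are not monotone, where it keeps the time in `[0,
1]`. -/
theorem endpoint_eq {a b : ℝ} (h0 : 0 ≤ a) (hab : a < b) (hb : b ≤ 1) :
    endpoint (-1) (b - a) ((b ^ 2 - a ^ 2) / 2) = a ∧
      endpoint 1 (b - a) ((b ^ 2 - a ^ 2) / 2) = b := by
  have hm : b - a ≠ 0 := (sub_pos.2 hab).ne'
  have h1 : (b ^ 2 - a ^ 2) / 2 / (b - a) = (a + b) / 2 := by field_simp; ring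
  constructor
  · rw [endpoint, h1, show (a + b) / 2 + -1 * (b - a) / 2 = a by ring,
      min_eq_right (hab.le.trans hb), max_eq_right h0]
  · rw [endpoint, h1, show (a + b) / 2 + 1 * (b - a) / 2 = b by ring,
      min_eq_right hb, max_eq_right (h0.trans hab.le)]

theorem measurable_endpoint {α : Type*} [MeasurableSpace α] (σ : ℝ) {m q : α → ℝ}
    (hm : Measurable m) (hq : Measurable q) : Measurable fun x => endpoint σ (m x) (q x) :=
  measurable_const.max (measurable_const.min ((hq.div hm).add ((hm.const_mul σ).div_const 2)))

/-- The integral over `[0, 1] ∩ s` of a derivative, where `s` is monotone. -/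
theorem integral_indicator_mul_deriv {s : Set ℝ} {f : ℝ → ℝ} (hf : Monotone f ∨ Antitone f)
    (h : s.indicator (fun _ => (1 : ℝ)) =ᵐ[volume] f) {g g' : ℝ → ℝ}
    (hg : ∀ t, HasDerivAt g (g' t) t) (hg' : Continuous g') {m q : ℝ}
    (hm : m = ∫ t in (0 : ℝ)..1, s.indicator (fun _ => (1 : ℝ)) t)
    (hq : q = ∫ t in (0 : ℝ)..1, s.indicator (fun _ => (1 : ℝ)) t * t) :
    ∫ t in (0 : ℝ)..1, s.indicator (fun _ => (1 : ℝ)) t * g' t =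
      g (endpoint 1 m q) - g (endpoint (-1) m q) := by
  obtain ⟨a, b, ha, hab, hb, hs⟩ := exists_integral_indicator_eq hf h
  have hm' : m = b - a := by simpa [hm] using hs fun _ => 1
  have hq' : q = (b ^ 2 - a ^ 2) / 2 := by rw [hq, hs]; simp
  rw [hs, intervalIntegral.integral_eq_sub_of_hasDerivAt (fun t _ => hg t)
    (hg'.intervalIntegrable _ _)]
  rcases hab.eq_or_lt with rfl | hab
  -- On an empty interval `0 / 0 = 0` makes both computed end points 0. They need not equal `a`, but
  -- they agree, so the difference vanishes.
  · simp [hm', hq', endpoint]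
  · rw [hm', hq', (endpoint_eq ha hab hb).1, (endpoint_eq ha hab hb).2]

/-! ### Haar measure and right translations -/

theorem measurable_mul_curve {G : Type*} [TopologicalSpace G] [Group G] [IsTopologicalGroup G]
    [SecondCountableTopology G] [MeasurableSpace G] [BorelSpace G] {γ : ℝ → G}
    (hγ : Continuous γ) : Measurable fun p : G × ℝ => p.1 * γ p.2 :=
  (continuous_fst.mul (hγ.comp continuous_snd)).measurable

section TopologicalGroup

variable {G : Type*} [TopologicalSpace G] [Group G] [IsTopologicalGroup G] [T2Space G]
  [LocallyCompactSpace G] [SecondCountableTopology G] [MeasurableSpace G] [BorelSpace G]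
  (μ : Measure G) [μ.IsHaarMeasure]

/-- Right translation along a one-parameter subgroup scales a Haar measure exponentially. -/
theorem exists_map_mul_right_eq_exp_smul {γ : ℝ → G} (hγ : Continuous γ)
    (hadd : ∀ s t, γ (s + t) = γ s * γ t) :
    ∃ c : ℝ, ∀ t, μ.map (· * γ t) = ENNReal.ofReal (Real.exp (c * t)) • μ := by
  have hmet : TopologicalSpace.PseudoMetrizableSpace G := inferInstance
  let D : ℝ → ℝ := fun t => (Measure.modularCharacterFun (γ t) : ℝ)
  have hmap : ∀ t, μ.map (· * γ t) = ENNReal.ofReal (D t) • μ := fun t => by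
    rw [Measure.map_right_mul_eq_modularCharacterFun_smul, ENNReal.ofReal_coe_nnreal]
    rfl
  have hpos : ∀ t, 0 < D t := fun t => by
    have := Measure.modularCharacterFun_pos (γ t)
    exact_mod_cast this
  have hDadd : ∀ s t, D (s + t) = D s * D t := fun s t => by
    simp only [D, hadd, Measure.modularCharacterFun_map_mul, NNReal.coe_mul]
  obtain ⟨K, hK, hK1⟩ := exists_compact_mem_nhds (1 : G)
  have hK0 : μ K ≠ 0 := (Measure.measure_pos_of_mem_nhds μ hK1).ne'
  have hKt : μ K ≠ ⊤ := hK.measure_lt_top.ne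
  -- `D t` is the factor by which integrating the indicator of `K` along the translation by `γ t`
  -- scales `μ K`; Tonelli makes this integral measurable in `t`.
  have hDm : Measurable D := by
    have h1 : Measurable fun t : ℝ => ∫⁻ x, K.indicator (fun _ => 1) (x * γ t) ∂μ := by
      refine Measurable.lintegral_prod_left'
        (f := fun p : G × ℝ => K.indicator (fun _ => (1 : ENNReal)) (p.1 * γ p.2)) ?_
      exact (measurable_one.indicator hK.measurableSet).comp (measurable_mul_curve hγ)
    have h2 : ∀ t, D t = ((∫⁻ x, K.indicator (fun _ => 1) (x * γ t) ∂μ) / μ K).toReal := by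
      intro t
      have : ∫⁻ x, K.indicator (fun _ => (1 : ENNReal)) (x * γ t) ∂μ
          = ENNReal.ofReal (D t) * μ K := by
        rw [← lintegral_map (f := K.indicator fun _ => (1 : ENNReal))
          (measurable_one.indicator hK.measurableSet) (measurable_mul_const (γ t)), hmap,
          lintegral_smul_measure, lintegral_indicator hK.measurableSet]
        simp
      rw [this, ENNReal.mul_div_cancel_right hK0 hKt, ENNReal.toReal_ofReal (hpos t).le]
    rw [funext h2]
    exact (h1.div_const _).ennreal_toReal
  -- A measurable additive function on the reals is continuous, hence linear; its slope is `c`.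
  let ℓ : ℝ →+ ℝ := AddMonoidHom.mk' (fun t => Real.log (D t)) fun s t => by
    rw [hDadd, Real.log_mul (hpos s).ne' (hpos t).ne']
  have hℓ : Continuous ℓ :=
    Measure.AddMonoidHom.continuous_of_measurable ℓ (Real.measurable_log.comp hDm)
  refine ⟨ℓ 1, fun t => ?_⟩
  have h3 : ℓ t = ℓ 1 * t := by
    have := (ℓ.toRealLinearMap hℓ).map_smul t 1
    simpa [mul_comm] using this
  rw [hmap, ← h3]
  congr
  exact (Real.exp_log (hpos t)).symm

end TopologicalGroup

/-! ### Left-invariant vector fields and their flows -/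

section NormedSpace

variable {V W : Type*} [NormedAddCommGroup V] [NormedSpace ℝ V] [NormedAddCommGroup W]
  [NormedSpace ℝ W]

theorem comp_one_smulRight {L : V →L[ℝ] W} {v : V} {w : W} (h : L v = w) :
    L.comp ((1 : ℝ →L[ℝ] ℝ).smulRight v) = (1 : ℝ →L[ℝ] ℝ).smulRight w := by
  ext
  simp [h]

theorem hasDerivAt_of_comp_one_smulRight {L : V →L[ℝ] W} {v : V} {f : ℝ → W} {t : ℝ}
    (h : HasFDerivAt f (L.comp ((1 : ℝ →L[ℝ] ℝ).smulRight v)) t) : HasDerivAt f (L v) t := by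
  simpa using h.hasDerivAt

end NormedSpace

section LieDeriv

variable {V : Type*} [NormedAddCommGroup V] [NormedSpace ℝ V] {G : Type*} [TopologicalSpace G]
  [ChartedSpace V G] [Group G]

theorem hasCompactSupport_lieDeriv (X : GroupLieAlgebra 𝓘(ℝ, V) G) {φ : G → ℝ}
    (hφ : HasCompactSupport φ) : HasCompactSupport (lieDeriv X φ) := by
  refine hφ.mono' fun g hg => ?_
  by_contra h
  apply hg
  have h1 : φ =ᶠ[nhds g] fun _ => 0 := notMem_tsupport_iff_eventuallyEq.1 h
  have h2 : mfderiv 𝓘(ℝ, V) 𝓘(ℝ, ℝ) φ g = 0 := by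
    rw [h1.mfderiv_eq]
    exact mfderiv_const
  rw [lieDeriv, h2]
  rfl

theorem lieDeriv_add (X Y : GroupLieAlgebra 𝓘(ℝ, V) G) (φ : G → ℝ) (g : G) :
    lieDeriv (X + Y) φ g = lieDeriv X φ g + lieDeriv Y φ g := by
  simp only [lieDeriv, mulInvariantVectorField_add, Pi.add_apply]
  exact map_add (mfderiv 𝓘(ℝ, V) 𝓘(ℝ, ℝ) φ g) _ _

theorem lieDeriv_smul (r : ℝ) (X : GroupLieAlgebra 𝓘(ℝ, V) G) (φ : G → ℝ) (g : G) :
    lieDeriv (r • X) φ g = r * lieDeriv X φ g := by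
  simp only [lieDeriv, mulInvariantVectorField_smul, Pi.smul_apply]
  exact map_smul (mfderiv 𝓘(ℝ, V) 𝓘(ℝ, ℝ) φ g) _ _

theorem IsFlowLine.hasDerivAt {X : GroupLieAlgebra 𝓘(ℝ, V) G} {γ : ℝ → G}
    (hγ : IsFlowLine X γ) {φ : G → ℝ} (hφ : ContMDiff 𝓘(ℝ, V) 𝓘(ℝ, ℝ) ∞ φ) (t : ℝ) :
    HasDerivAt (fun t => φ (γ t)) (lieDeriv X φ (γ t)) t := by
  have h1 := ((hφ.contMDiffAt (x := γ t)).mdifferentiableAt (by simp)).hasMFDerivAt.comp t (hγ t)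
  exact hasDerivAt_of_comp_one_smulRight (V := V) (W := ℝ) (hasMFDerivAt_iff_hasFDerivAt.1 h1)

end LieDeriv

section LieGroup

variable {V : Type*} [NormedAddCommGroup V] [NormedSpace ℝ V] {G : Type*} [TopologicalSpace G]
  [ChartedSpace V G] [Group G] [LieGroup 𝓘(ℝ, V) ∞ G]

theorem contMDiff_one_mulInvariantVectorField (X : GroupLieAlgebra 𝓘(ℝ, V) G) :
    ContMDiff 𝓘(ℝ, V) 𝓘(ℝ, V).tangent 1 (fun g : G =>
      (⟨g, mulInvariantVectorField X g⟩ : TangentBundle 𝓘(ℝ, V) G)) :=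
  (contMDiff_mulInvariantVectorField X).of_le (by
    simp only [minSmoothness_of_isRCLikeNormedField]
    exact one_le_two)

theorem mfderiv_mul_left_mulInvariantVectorField (X : GroupLieAlgebra 𝓘(ℝ, V) G) (g h : G) :
    mfderiv 𝓘(ℝ, V) 𝓘(ℝ, V) (g * ·) h (mulInvariantVectorField X h) =
      mulInvariantVectorField X (g * h) := by
  have hd : ∀ k l : G, MDifferentiableAt 𝓘(ℝ, V) 𝓘(ℝ, V) (k * ·) l := fun k l =>
    (contMDiff_mul_left (n := ∞)).contMDiffAt.mdifferentiableAt (by simp)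
  have h1 : (fun x => g * h * x) = (fun x => g * x) ∘ (fun x => h * x) := by
    ext x
    simp [mul_assoc]
  have h2 := mfderiv_comp_of_eq (I := 𝓘(ℝ, V)) (I' := 𝓘(ℝ, V)) (I'' := 𝓘(ℝ, V)) (x := (1 : G))
    (f := fun x => h * x) (g := fun x => g * x) (y := h) (hd g h) (hd h 1) (mul_one h)
  simp only [mulInvariantVectorField]
  -- The base points `h * 1` and `h` are equal only propositionally, so the derivative is
  -- transported with `v` regarded as a vector of `V`.
  have h3 : ∀ k : G, k = h → ∀ v : V, (mfderiv 𝓘(ℝ, V) 𝓘(ℝ, V) (g * ·) h : V → V) v =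
      (mfderiv 𝓘(ℝ, V) 𝓘(ℝ, V) (g * ·) k : V → V) v := by
    rintro _ rfl v
    rfl
  rw [h1, h2]
  exact h3 _ (mul_one h) _

/-- Left translations map flow lines to flow lines. -/
theorem isMIntegralCurveOn_const_mul {X : GroupLieAlgebra 𝓘(ℝ, V) G} {γ : ℝ → G} {s : Set ℝ}
    (hγ : IsMIntegralCurveOn γ
      (fun g : G => (mulInvariantVectorField X g : TangentSpace 𝓘(ℝ, V) g)) s) (x : G) :
    IsMIntegralCurveOn (fun t => x * γ t)
      (fun g : G => (mulInvariantVectorField X g : TangentSpace 𝓘(ℝ, V) g)) s := by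
  intro t ht
  have hd : HasMFDerivAt 𝓘(ℝ, V) 𝓘(ℝ, V) (x * ·) (γ t) _ :=
    ((contMDiff_mul_left (n := ∞)).contMDiffAt.mdifferentiableAt (by simp)).hasMFDerivAt
  have := hd.comp_hasMFDerivWithinAt t (hγ t ht)
  refine HasMFDerivWithinAt.congr_mfderiv this ?_
  exact comp_one_smulRight (V := V) (W := V)
    (mfderiv_mul_left_mulInvariantVectorField X x (γ t))

/-- Left-invariant vector fields are complete. -/
theorem exists_isFlowLine [FiniteDimensional ℝ V] [T2Space G] (X : GroupLieAlgebra 𝓘(ℝ, V) G) :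
    ∃ γ : ℝ → G, γ 0 = 1 ∧ IsFlowLine X γ := by
  have : CompleteSpace V := FiniteDimensional.complete ℝ V
  have : IsManifold 𝓘(ℝ, V) 1 G := IsManifold.of_le (n := ∞) (by simp)
  have hv := contMDiff_one_mulInvariantVectorField X
  obtain ⟨γ, h0, hγ⟩ := exists_isMIntegralCurveAt_of_contMDiffAt_boundaryless (t₀ := 0)
    (hv.contMDiffAt (x := (1 : G)))
  obtain ⟨ε, hε, hγ⟩ := isMIntegralCurveAt_iff'.1 hγ
  rw [Real.ball_eq_Ioo, zero_sub, zero_add] at hγ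
  -- Left translates of one local solution at 1 have the same life span `ε` at every point, so
  -- solutions extend to all times.
  exact exists_isMIntegralCurve_of_isMIntegralCurveOn hv hε
    (fun x => ⟨fun t => x * γ t, by simp [h0], isMIntegralCurveOn_const_mul hγ x⟩) 1

/-- Both sides, as functions of `t`, are integral curves that pass through `γ s` at time 0, so
uniqueness identifies them. -/
theorem IsFlowLine.map_add [T2Space G] {X : GroupLieAlgebra 𝓘(ℝ, V) G} {γ : ℝ → G}
    (hγ : IsFlowLine X γ) (h0 : γ 0 = 1) (s t : ℝ) : γ (s + t) = γ s * γ t := by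
  have : IsManifold 𝓘(ℝ, V) 1 G := IsManifold.of_le (n := ∞) (by simp)
  have h1 := IsMIntegralCurve.comp_add hγ s
  have h2 := isMIntegralCurve_iff_isMIntegralCurveOn.2
    (isMIntegralCurveOn_const_mul (hγ.isMIntegralCurveOn univ) (γ s))
  have := congrFun (isMIntegralCurve_Ioo_eq_of_contMDiff_boundaryless (t₀ := 0)
    (contMDiff_one_mulInvariantVectorField X) h1 h2 (by simp [h0])) t
  simpa [add_comm] using this

theorem continuous_lieDeriv (X : GroupLieAlgebra 𝓘(ℝ, V) G) {φ : G → ℝ}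
    (hφ : ContMDiff 𝓘(ℝ, V) 𝓘(ℝ, ℝ) ∞ φ) : Continuous (lieDeriv X φ) := by
  have : IsManifold 𝓘(ℝ, V) 1 G := IsManifold.of_le (n := ∞) (by simp)
  have h1 := (hφ.of_le (m := 1) (by simp)).continuous_tangentMap le_rfl
  have h2 := (contMDiff_snd_tangentBundle_modelSpace (n := 1) ℝ 𝓘(ℝ, ℝ)).continuous
  exact h2.comp (h1.comp (contMDiff_one_mulInvariantVectorField X).continuous)

end LieGroup

/-! ### Averaging along a one-parameter subgroup -/

section TopologicalGroup

open scoped Pointwise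

variable {G : Type*} [TopologicalSpace G] [Group G] [IsTopologicalGroup G] [T2Space G]
  [LocallyCompactSpace G] [SecondCountableTopology G] [MeasurableSpace G] [BorelSpace G]
  {μ : Measure G} [μ.IsHaarMeasure] {γ : ℝ → G} {c : ℝ} {E : Set G}

theorem integrable_indicator_comp_mul_curve (hγ : Continuous γ)
    (hE : MeasurableSet E) {F : G → ℝ} (hF : Continuous F) (hF' : HasCompactSupport F) :
    Integrable (fun p : G × ℝ => {t | p.1 * γ t ∈ E}.indicator (fun _ => (1 : ℝ)) p.2 *
      (Real.exp (-c * p.2) * F (p.1 * γ p.2))) (μ.prod (volume.restrict (Ioc 0 1))) := by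
  have hcont : Continuous fun p : G × ℝ => Real.exp (-c * p.2) * F (p.1 * γ p.2) := by fun_prop
  -- If `x * γ t` lies in the support of `F` for some `t` in `[0, 1]`, then `x` lies in this compact
  -- set.
  have hK : IsCompact (tsupport F * (γ '' Icc 0 1)⁻¹) :=
    hF'.isCompact.mul (isCompact_Icc.image hγ).inv
  have h1 : IntegrableOn (fun p : G × ℝ => Real.exp (-c * p.2) * F (p.1 * γ p.2))
      (univ ×ˢ Ioc 0 1) (μ.prod volume) := by
    refine IntegrableOn.of_forall_sdiff_eq_zero
      (hcont.continuousOn.integrableOn_compact (hK.prod (isCompact_Icc (a := (0 : ℝ)) (b := 1))))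
      (MeasurableSet.univ.prod measurableSet_Ioc) fun p hp => ?_
    have hp1 : p.2 ∈ Icc (0 : ℝ) 1 := Ioc_subset_Icc_self hp.1.2
    have : p.1 * γ p.2 ∉ tsupport F := fun h => hp.2
      ⟨⟨_, h, _, inv_mem_inv.2 ⟨p.2, hp1, rfl⟩, by simp⟩, hp1⟩
    rw [image_eq_zero_of_notMem_tsupport this, mul_zero]
  rw [IntegrableOn, ← Measure.prod_restrict, Measure.restrict_univ] at h1
  refine (h1.indicator (measurable_mul_curve hγ hE)).congr (ae_of_all _ fun p => ?_)
  by_cases hp : p.1 * γ p.2 ∈ E <;> simp [hp]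

/-- Integrals over `G` are averages of integrals along the translates of a one-parameter
subgroup. -/
theorem setIntegral_eq_integral_curve (hγ : Continuous γ)
    (hc : ∀ t, μ.map (· * γ t) = ENNReal.ofReal (Real.exp (c * t)) • μ)
    (hE : MeasurableSet E) {F : G → ℝ} (hF : Continuous F) (hF' : HasCompactSupport F) :
    ∫ x in E, F x ∂μ = ∫ x, (∫ t in (0 : ℝ)..1,
      {t | x * γ t ∈ E}.indicator (fun _ => (1 : ℝ)) t * (Real.exp (-c * t) * F (x * γ t))) ∂μ := by
  -- The weight cancels the scaling of `μ`, so the integral over `x` does not depend on `t`.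
  have h1 : ∀ t, ∫ x, {t | x * γ t ∈ E}.indicator (fun _ => (1 : ℝ)) t *
      (Real.exp (-c * t) * F (x * γ t)) ∂μ = ∫ x in E, F x ∂μ := by
    intro t
    have h2 : ∫ x, E.indicator F (x * γ t) ∂μ = Real.exp (c * t) * ∫ x in E, F x ∂μ := by
      rw [← integral_map (f := E.indicator F) (measurable_mul_const (γ t)).aemeasurable
        (hF.measurable.indicator hE).aestronglyMeasurable, hc, integral_smul_measure,
        integral_indicator hE, ENNReal.toReal_ofReal (Real.exp_pos _).le, smul_eq_mul]
    have h3 : ∀ x, {t | x * γ t ∈ E}.indicator (fun _ => (1 : ℝ)) t *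
        (Real.exp (-c * t) * F (x * γ t)) = Real.exp (-c * t) * E.indicator F (x * γ t) := by
      intro x
      by_cases hx : x * γ t ∈ E <;> simp [hx]
    simp_rw [h3]
    rw [integral_const_mul, h2, ← mul_assoc, ← Real.exp_add]
    simp
  simp_rw [intervalIntegral.integral_of_le zero_le_one]
  rw [integral_integral_swap (integrable_indicator_comp_mul_curve hγ hE hF hF')]
  simp_rw [h1]
  simp

/-- The image of the measure with density `e ^ (-c τ)` under the map which moves each point `x`
for the time `τ x` along a one-parameter subgroup. -/
noncomputable def endpointMeasure (μ : Measure G) (γ : ℝ → G) (c : ℝ) (τ : G → ℝ) : Measure G :=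
  (μ.withDensity fun x => ENNReal.ofReal (Real.exp (-c * τ x))).map fun x => x * γ (τ x)

theorem isFiniteMeasureOnCompacts_endpointMeasure (hγ : Continuous γ) {τ : G → ℝ}
    (hτ : Measurable τ) (hτ' : ∀ x, τ x ∈ Icc (0 : ℝ) 1) :
    IsFiniteMeasureOnCompacts (endpointMeasure μ γ c τ) := by
  refine ⟨fun K hK => ?_⟩
  have hK' : IsCompact (K * (γ '' Icc 0 1)⁻¹) := hK.mul (isCompact_Icc.image hγ).inv
  have hmeas : Measurable fun x => x * γ (τ x) :=
    (measurable_mul_curve hγ).comp (measurable_id.prodMk hτ)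
  have hsub : (fun x => x * γ (τ x)) ⁻¹' K ⊆ K * (γ '' Icc 0 1)⁻¹ := fun x hx =>
    ⟨_, hx, _, inv_mem_inv.2 ⟨τ x, hτ' x, rfl⟩, by simp⟩
  rw [endpointMeasure, Measure.map_apply hmeas hK.measurableSet,
    withDensity_apply _ (hmeas hK.measurableSet)]
  calc ∫⁻ x in (fun x => x * γ (τ x)) ⁻¹' K, ENNReal.ofReal (Real.exp (-c * τ x)) ∂μ
      ≤ ∫⁻ _ in (fun x => x * γ (τ x)) ⁻¹' K, ENNReal.ofReal (Real.exp |c|) ∂μ := by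
        refine lintegral_mono fun x => ENNReal.ofReal_le_ofReal (Real.exp_le_exp.2 ?_)
        calc -c * τ x ≤ |c| * τ x := mul_le_mul_of_nonneg_right (neg_le_abs c) (hτ' x).1
          _ ≤ |c| := mul_le_of_le_one_right (abs_nonneg c) (hτ' x).2
    _ ≤ ENNReal.ofReal (Real.exp |c|) * μ (K * (γ '' Icc 0 1)⁻¹) := by
        rw [setLIntegral_const]
        exact mul_le_mul_right (measure_mono hsub) _
    _ < ⊤ := ENNReal.mul_lt_top ENNReal.ofReal_lt_top hK'.measure_lt_top

theorem integrable_and_integral_endpointMeasure (hγ : Continuous γ) {τ : G → ℝ}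
    (hτ : Measurable τ) (hτ' : ∀ x, τ x ∈ Icc (0 : ℝ) 1) {φ : G → ℝ} (hφ : Continuous φ)
    (hφ' : HasCompactSupport φ) :
    Integrable (fun x => Real.exp (-c * τ x) * φ (x * γ (τ x))) μ ∧
      ∫ x, φ x ∂(endpointMeasure μ γ c τ) =
        ∫ x, Real.exp (-c * τ x) * φ (x * γ (τ x)) ∂μ := by
  have := isFiniteMeasureOnCompacts_endpointMeasure (μ := μ) (c := c) hγ hτ hτ'
  have hmeas : Measurable fun x => x * γ (τ x) :=
    (measurable_mul_curve hγ).comp (measurable_id.prodMk hτ)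
  have hdens : Measurable fun x => ENNReal.ofReal (Real.exp (-c * τ x)) :=
    ENNReal.measurable_ofReal.comp (Real.measurable_exp.comp (hτ.const_mul _))
  have hfin : ∀ᵐ x ∂μ, ENNReal.ofReal (Real.exp (-c * τ x)) < ⊤ :=
    ae_of_all _ fun x => ENNReal.ofReal_lt_top
  have hint : Integrable φ (endpointMeasure μ γ c τ) := hφ.integrable_of_hasCompactSupport hφ'
  constructor
  · rw [endpointMeasure, integrable_map_measure hφ.aestronglyMeasurable hmeas.aemeasurable,
      integrable_withDensity_iff_integrable_smul' hdens hfin] at hint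
    simpa [ENNReal.toReal_ofReal (Real.exp_pos _).le] using hint
  · rw [endpointMeasure, integral_map hmeas.aemeasurable hφ.aestronglyMeasurable,
      integral_withDensity_eq_integral_toReal_smul hdens hfin]
    simp [ENNReal.toReal_ofReal (Real.exp_pos _).le]

/-- If almost every translate of a one-parameter subgroup is monotone for `E`, then the derivative
of the indicator function of `E` along these translates is a measure. -/
theorem exists_setIntegral_deriv_eq (hγ : Continuous γ)
    (hc : ∀ t, μ.map (· * γ t) = ENNReal.ofReal (Real.exp (c * t)) • μ) (hE : MeasurableSet E)
    (hmono : ∀ᵐ x ∂μ, ∃ f : ℝ → ℝ, (Monotone f ∨ Antitone f) ∧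
      {t | x * γ t ∈ E}.indicator (fun _ => (1 : ℝ)) =ᵐ[volume] f) :
    ∃ ν₁ ν₂ : Measure G, IsFiniteMeasureOnCompacts ν₁ ∧ IsFiniteMeasureOnCompacts ν₂ ∧
      ∀ φ F : G → ℝ, Continuous φ → HasCompactSupport φ → Continuous F → HasCompactSupport F →
        (∀ x t, HasDerivAt (fun t => φ (x * γ t)) (F (x * γ t)) t) →
        ∫ x in E, F x ∂μ - c * ∫ x in E, φ x ∂μ = ∫ x, φ x ∂ν₁ - ∫ x, φ x ∂ν₂ := by
  have hind : Measurable fun p : G × ℝ => {t | p.1 * γ t ∈ E}.indicator (fun _ => (1 : ℝ)) p.2 :=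
    (measurable_one.indicator hE).comp (measurable_mul_curve hγ)
  -- Length and first moment are integrals, so Fubini makes them, and the end points computed from
  -- them, measurable in `x`.
  let m : G → ℝ := fun x => ∫ t in (0 : ℝ)..1, {t | x * γ t ∈ E}.indicator (fun _ => (1 : ℝ)) t
  let q : G → ℝ := fun x =>
    ∫ t in (0 : ℝ)..1, {t | x * γ t ∈ E}.indicator (fun _ => (1 : ℝ)) t * t
  have hm : Measurable m := by
    simp only [m, intervalIntegral.integral_of_le zero_le_one]
    exact hind.stronglyMeasurable.integral_prod_right.measurable
  have hq : Measurable q := by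
    simp only [q, intervalIntegral.integral_of_le zero_le_one]
    exact (hind.mul measurable_snd).stronglyMeasurable.integral_prod_right.measurable
  have hend : ∀ σ, Measurable fun x => endpoint σ (m x) (q x) := fun σ =>
    measurable_endpoint σ hm hq
  have hend' : ∀ σ x, endpoint σ (m x) (q x) ∈ Icc (0 : ℝ) 1 := fun σ x => endpoint_mem_Icc _ _ _
  refine ⟨endpointMeasure μ γ c fun x => endpoint 1 (m x) (q x),
    endpointMeasure μ γ c fun x => endpoint (-1) (m x) (q x),
    isFiniteMeasureOnCompacts_endpointMeasure hγ (hend 1) (hend' 1),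
    isFiniteMeasureOnCompacts_endpointMeasure hγ (hend _) (hend' _), ?_⟩
  intro φ F hφ hφ' hF hF' hderiv
  -- The derivative of `exp (-c * t) * φ (x * γ t)` is `exp (-c * t)` times this function at `x * γ
  -- t`.
  have hFc : Continuous fun x => F x - c * φ x := by fun_prop
  have hFc' : HasCompactSupport fun x => F x - c * φ x :=
    hF'.sub (HasCompactSupport.mul_left (f := fun _ => c) hφ')
  obtain ⟨hi₁, he₁⟩ := integrable_and_integral_endpointMeasure (μ := μ) (c := c) hγ (hend 1)
    (hend' 1) hφ hφ'
  obtain ⟨hi₂, he₂⟩ := integrable_and_integral_endpointMeasure (μ := μ) (c := c) hγ (hend (-1))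
    (hend' (-1)) hφ hφ'
  have hFi : Integrable F μ := hF.integrable_of_hasCompactSupport hF'
  have hφi : Integrable φ μ := hφ.integrable_of_hasCompactSupport hφ'
  rw [he₁, he₂, ← integral_sub hi₁ hi₂, ← integral_const_mul,
    ← integral_sub hFi.integrableOn (hφi.const_mul c).integrableOn,
    setIntegral_eq_integral_curve hγ hc hE hFc hFc']
  refine integral_congr_ae ?_
  filter_upwards [hmono] with x ⟨f, hf, hxf⟩
  have hcurve : Continuous fun t => x * γ t := continuous_const.mul hγ
  refine integral_indicator_mul_deriv hf hxf
    (g := fun t => Real.exp (-c * t) * φ (x * γ t)) (fun t => ?_) ?_ rfl rfl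
  · have h1 : HasDerivAt (fun t => Real.exp (-c * t)) (Real.exp (-c * t) * -c) t := by
      simpa using ((hasDerivAt_id t).const_mul (-c)).exp
    convert! h1.mul (hderiv x t) using 1
    ring
  · fun_prop

end TopologicalGroup

/-! ### Signed Radon measures as functionals -/

theorem regular_of_isFiniteMeasureOnCompacts {G : Type*} [TopologicalSpace G] [T2Space G]
    [LocallyCompactSpace G] [SecondCountableTopology G] [MeasurableSpace G] [BorelSpace G]
    (ν : Measure G) [IsFiniteMeasureOnCompacts ν] : ν.Regular := by
  have : TopologicalSpace.MetrizableSpace G := inferInstance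
  exact inferInstance

/-- A proper subspace is null for Haar measure, so it cannot also have full measure. -/
theorem eq_top_of_ae_mem {V : Type*} [NormedAddCommGroup V] [NormedSpace ℝ V]
    [FiniteDimensional ℝ V] {W : Submodule ℝ V} [MeasurableSpace W] [BorelSpace W]
    (ν : Measure W) [ν.IsAddHaarMeasure] {P : Submodule ℝ W} (h : ∀ᵐ X ∂ν, X ∈ P) : P = ⊤ := by
  by_contra hP
  have h0 : ∀ᵐ X ∂ν, X ∉ P := measure_eq_zero_iff_ae_notMem.1 (Measure.addHaar_submodule ν P hP)
  have h1 : ∀ᵐ _ ∂ν, False := by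
    filter_upwards [h, h0] with X hX hX'
    exact hX' hX
  exact NeZero.ne ν (by simpa using h1)

section IsSignedRadon

variable {V : Type*} [NormedAddCommGroup V] [NormedSpace ℝ V] {G : Type*} [TopologicalSpace G]
  [ChartedSpace V G] [MeasurableSpace G]

/-- A functional agrees on test functions with a difference of two Radon measures. -/
def IsSignedRadon (V : Type*) [NormedAddCommGroup V] [NormedSpace ℝ V] {G : Type*}
    [TopologicalSpace G] [ChartedSpace V G] [MeasurableSpace G] (T : (G → ℝ) → ℝ) : Prop :=
  ∃ ν₁ ν₂ : Measure G, ν₁.Regular ∧ ν₂.Regular ∧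
    ∀ φ : G → ℝ, ContMDiff 𝓘(ℝ, V) 𝓘(ℝ, ℝ) ∞ φ → HasCompactSupport φ →
      T φ = ∫ g, φ g ∂ν₁ - ∫ g, φ g ∂ν₂

theorem IsSignedRadon.congr {T T' : (G → ℝ) → ℝ} (hT : IsSignedRadon V T)
    (h : ∀ φ : G → ℝ, ContMDiff 𝓘(ℝ, V) 𝓘(ℝ, ℝ) ∞ φ → HasCompactSupport φ → T' φ = T φ) :
    IsSignedRadon V T' := by
  obtain ⟨ν₁, ν₂, h₁, h₂, hν⟩ := hT
  exact ⟨ν₁, ν₂, h₁, h₂, fun φ hφ hφ' => (h φ hφ hφ').trans (hν φ hφ hφ')⟩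

theorem isSignedRadon_integral (ν : Measure G) [ν.Regular] :
    IsSignedRadon V fun φ : G → ℝ => ∫ g, φ g ∂ν :=
  ⟨ν, 0, inferInstance, inferInstance, by simp⟩

theorem IsSignedRadon.smul {T : (G → ℝ) → ℝ} (hT : IsSignedRadon V T) (r : ℝ) :
    IsSignedRadon V fun φ => r * T φ := by
  obtain ⟨ν₁, ν₂, h₁, h₂, hν⟩ := hT
  rcases le_total 0 r with hr | hr
  · refine ⟨r.toNNReal • ν₁, r.toNNReal • ν₂, inferInstance, inferInstance, fun φ hφ hφ' => ?_⟩
    beta_reduce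
    rw [hν φ hφ hφ', integral_smul_nnreal_measure, integral_smul_nnreal_measure, NNReal.smul_def,
      NNReal.smul_def, Real.coe_toNNReal r hr, smul_eq_mul, smul_eq_mul]
    ring
  · refine ⟨(-r).toNNReal • ν₂, (-r).toNNReal • ν₁, inferInstance, inferInstance,
      fun φ hφ hφ' => ?_⟩
    beta_reduce
    rw [hν φ hφ hφ', integral_smul_nnreal_measure, integral_smul_nnreal_measure, NNReal.smul_def,
      NNReal.smul_def, Real.coe_toNNReal (-r) (neg_nonneg.2 hr), smul_eq_mul, smul_eq_mul]
    ring

variable [T2Space G] [LocallyCompactSpace G] [SecondCountableTopology G] [BorelSpace G]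

theorem IsSignedRadon.add {T T' : (G → ℝ) → ℝ} (hT : IsSignedRadon V T)
    (hT' : IsSignedRadon V T') : IsSignedRadon V fun φ => T φ + T' φ := by
  obtain ⟨ν₁, ν₂, h₁, h₂, hν⟩ := hT
  obtain ⟨ν₁', ν₂', h₁', h₂', hν'⟩ := hT'
  have hadd : ∀ (ν ν' : Measure G) [ν.Regular] [ν'.Regular],
      IsFiniteMeasureOnCompacts (ν + ν') := fun ν ν' _ _ =>
    ⟨fun K hK => ENNReal.add_lt_top.2 ⟨hK.measure_lt_top, hK.measure_lt_top⟩⟩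
  have := hadd ν₁ ν₁'
  have := hadd ν₂ ν₂'
  refine ⟨ν₁ + ν₁', ν₂ + ν₂', regular_of_isFiniteMeasureOnCompacts _,
    regular_of_isFiniteMeasureOnCompacts _, fun φ hφ hφ' => ?_⟩
  have hi : ∀ (ν : Measure G) [ν.Regular], Integrable φ ν := fun ν _ =>
    hφ.continuous.integrable_of_hasCompactSupport hφ'
  beta_reduce
  rw [hν φ hφ hφ', hν' φ hφ hφ', integral_add_measure (hi ν₁) (hi ν₁'),
    integral_add_measure (hi ν₂) (hi ν₂')]
  ring

end IsSignedRadon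

/-! ### From almost every direction to every direction -/

section LieGroup

variable {V : Type*} [NormedAddCommGroup V] [NormedSpace ℝ V] [FiniteDimensional ℝ V]
  {G : Type*} [TopologicalSpace G] [ChartedSpace V G] [Group G] [LieGroup 𝓘(ℝ, V) ∞ G]
  [T2Space G] [SecondCountableTopology G] [MeasurableSpace G] [BorelSpace G]
  {μ : Measure G} [μ.IsHaarMeasure] {A : Set G}

/-- The left-invariant vector fields whose derivatives of the indicator function of `A` are Radon
measures form a linear subspace. -/
theorem exists_submodule_derivIsRadon (W : Submodule ℝ (GroupLieAlgebra 𝓘(ℝ, V) G)) :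
    ∃ P : Submodule ℝ W, ∀ X, X ∈ P ↔
      DerivIsRadon μ A (X : GroupLieAlgebra 𝓘(ℝ, V) G) := by
  have : IsTopologicalGroup G := topologicalGroup_of_lieGroup 𝓘(ℝ, V) ∞
  have : LocallyCompactSpace G := ChartedSpace.locallyCompactSpace V G
  have hi : ∀ (X : GroupLieAlgebra 𝓘(ℝ, V) G) (φ : G → ℝ), ContMDiff 𝓘(ℝ, V) 𝓘(ℝ, ℝ) ∞ φ →
      HasCompactSupport φ → Integrable (lieDeriv X φ) (μ.restrict A) := fun X φ hφ hφ' =>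
    ((continuous_lieDeriv X hφ).integrable_of_hasCompactSupport
      (hasCompactSupport_lieDeriv X hφ')).integrableOn
  have hsmul : ∀ (r : ℝ) (X : GroupLieAlgebra 𝓘(ℝ, V) G), DerivIsRadon μ A X →
      DerivIsRadon μ A (r • X) := fun r X hX => by
    refine IsSignedRadon.congr (IsSignedRadon.smul hX r) fun φ hφ hφ' => ?_
    simp_rw [lieDeriv_smul]
    rw [integral_const_mul]
    ring
  refine ⟨{ carrier := {X | DerivIsRadon μ A (X : GroupLieAlgebra 𝓘(ℝ, V) G)}
            add_mem' := fun {X Y} hX hY => ?_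
            zero_mem' := ?_
            smul_mem' := fun r X hX => hsmul r X hX }, fun X => Iff.rfl⟩
  · refine IsSignedRadon.congr (IsSignedRadon.add hX hY) fun φ hφ hφ' => ?_
    simp_rw [Submodule.coe_add, lieDeriv_add]
    rw [integral_add (hi _ φ hφ hφ') (hi _ φ hφ hφ')]
    ring
  · refine IsSignedRadon.congr (isSignedRadon_integral 0) fun φ hφ hφ' => ?_
    have : ∀ g, lieDeriv (0 : GroupLieAlgebra 𝓘(ℝ, V) G) φ g = 0 := fun g => by
      simpa using lieDeriv_smul 0 (0 : GroupLieAlgebra 𝓘(ℝ, V) G) φ g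
    simp [this]

theorem derivIsRadon_of_ae_isMonotoneFor {S : Stratification (GroupLieAlgebra 𝓘(ℝ, V) G)}
    (hA : NullMeasurableSet A μ) {X : S.layer 1} (hX : X ≠ 0)
    (h : ∀ᵐ x ∂μ, ∀ L : Line S, L.IsThrough X x → L.IsMonotoneFor A) :
    DerivIsRadon μ A (X : GroupLieAlgebra 𝓘(ℝ, V) G) := by
  have : IsTopologicalGroup G := topologicalGroup_of_lieGroup 𝓘(ℝ, V) ∞
  have : LocallyCompactSpace G := ChartedSpace.locallyCompactSpace V G
  have hX' : (X : GroupLieAlgebra 𝓘(ℝ, V) G) ≠ 0 := fun h0 => hX (Subtype.ext h0)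
  obtain ⟨γ, h0, hγ⟩ := exists_isFlowLine (X : GroupLieAlgebra 𝓘(ℝ, V) G)
  have hcont : Continuous γ := IsMIntegralCurve.continuous hγ
  have htrans : ∀ x, IsFlowLine (X : GroupLieAlgebra 𝓘(ℝ, V) G) fun t => x * γ t := fun x =>
    isMIntegralCurve_iff_isMIntegralCurveOn.2
      (isMIntegralCurveOn_const_mul (IsMIntegralCurve.isMIntegralCurveOn hγ univ) x)
  obtain ⟨c, hc⟩ := exists_map_mul_right_eq_exp_smul μ hcont (hγ.map_add h0)
  -- The curve argument needs a Borel set. Right translations along `γ` preserve null sets, so by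
  -- Fubini `E` and `A` agree almost everywhere along almost every curve.
  obtain ⟨E, -, hE, hEA⟩ := hA.exists_measurable_superset_ae_eq
  have hae : ∀ᵐ x ∂μ, ∀ᵐ t : ℝ, x * γ t ∈ E ↔ x * γ t ∈ A := by
    obtain ⟨N, hN, hN', hN0⟩ := exists_measurable_superset_of_null
      (ae_iff.1 (hEA.mem_iff))
    have hNm : MeasurableSet {p : G × ℝ | p.1 * γ p.2 ∈ N} := measurable_mul_curve hcont hN'
    have h1 : ∀ᵐ t : ℝ, ∀ᵐ x ∂μ, ¬ x * γ t ∈ N := by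
      refine ae_of_all _ fun t => ?_
      have h2 : μ.map (· * γ t) N = 0 := by rw [hc]; simp [hN0]
      rw [Measure.map_apply (measurable_mul_const _) hN'] at h2
      exact measure_eq_zero_iff_ae_notMem.1 h2
    have h2 := (Measure.ae_ae_comm (μ := μ) (ν := (volume : Measure ℝ))
      (p := fun x t => ¬ x * γ t ∈ N) hNm.compl).2 h1
    filter_upwards [h2] with x hx
    filter_upwards [hx] with t ht
    by_contra h3
    exact ht (hN h3)
  have hmono : ∀ᵐ x ∂μ, ∃ f : ℝ → ℝ, (Monotone f ∨ Antitone f) ∧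
      {t | x * γ t ∈ E}.indicator (fun _ => (1 : ℝ)) =ᵐ[volume] f := by
    filter_upwards [h, hae] with x hx hxE
    let L : Line S := ⟨range fun t => x * γ t, X, X.2, hX', _, htrans x, rfl⟩
    obtain ⟨f, hf, hfA⟩ := hx L ⟨hX, _, htrans x, by simp [h0], rfl⟩ X X.2 hX' _ (htrans x) rfl
    refine ⟨f, hf, ?_⟩
    filter_upwards [hfA, hxE] with t ht htE
    rw [← ht]
    by_cases hxt : x * γ t ∈ A
    · simp [hxt, htE.2 hxt]
    · simp [hxt, mt htE.1 hxt]
  obtain ⟨ν₁, ν₂, h₁, h₂, hν⟩ := exists_setIntegral_deriv_eq hcont hc hE hmono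
  have := regular_of_isFiniteMeasureOnCompacts ν₁
  have := regular_of_isFiniteMeasureOnCompacts ν₂
  have : IsFiniteMeasureOnCompacts (μ.restrict E) :=
    ⟨fun K hK => (Measure.restrict_apply_le E K).trans_lt hK.measure_lt_top⟩
  have := regular_of_isFiniteMeasureOnCompacts (μ.restrict E)
  -- Solving the identity `hν` for the distribution gives `-∫_E Xφ = ∫ φ dν₂ - ∫ φ dν₁ - c * ∫_E φ`.
  refine IsSignedRadon.congr (((isSignedRadon_integral ν₂).add
    ((isSignedRadon_integral ν₁).smul (-1))).add
    ((isSignedRadon_integral (μ.restrict E)).smul (-c))) fun φ hφ hφ' => ?_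
  have := hν φ (lieDeriv (X : GroupLieAlgebra 𝓘(ℝ, V) G) φ) hφ.continuous hφ'
    (continuous_lieDeriv _ hφ) (hasCompactSupport_lieDeriv _ hφ')
    fun x t => IsFlowLine.hasDerivAt (htrans x) hφ t
  rw [← setIntegral_congr_set hEA]
  linarith

theorem IsMonotoneSet.hasLocallyFinitePerimeter
    {S : Stratification (GroupLieAlgebra 𝓘(ℝ, V) G)} (hA : IsMonotoneSet S μ A) :
    HasLocallyFinitePerimeter S μ A := by
  have : IsTopologicalGroup G := topologicalGroup_of_lieGroup 𝓘(ℝ, V) ∞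
  have : LocallyCompactSpace G := ChartedSpace.locallyCompactSpace V G
  refine ⟨hA.1, ?_⟩
  obtain ⟨P, hP⟩ := exists_submodule_derivIsRadon (μ := μ) (A := A) (S.layer 1)
  have hae : ∀ᵐ X ∂(Measure.addHaar : Measure (S.layer 1)), X ∈ P := by
    have h1 := Measure.ae_ae_of_ae_prod (measure_eq_zero_iff_ae_notMem.1 hA.2)
    filter_upwards [h1] with X hX
    rcases eq_or_ne X 0 with rfl | hX0
    · exact P.zero_mem
    refine (hP X).2 (derivIsRadon_of_ae_isMonotoneFor hA.1 hX0 ?_)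
    filter_upwards [hX] with x hx L hL
    by_contra hLm
    exact hx ⟨L, hLm, hL⟩
  have htop : P = ⊤ := by
    have hH : (Measure.addHaar : Measure (S.layer 1)).IsAddHaarMeasure := inferInstance
    exact @eq_top_of_ae_mem V _ _ _ (S.layer 1) (instMeasurableSpaceLayer S 1)
      (instBorelSpaceLayer S 1) _ hH P hae
  intro X hX
  exact (hP ⟨X, hX⟩).1 (htop ▸ Submodule.mem_top)

end LieGroup

end CarnotGroup

theorem theorem1p1
    {V : Type*} [NormedAddCommGroup V] [NormedSpace ℝ V] [FiniteDimensional ℝ V]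
    {G : Type*} [TopologicalSpace G] [T2Space G] [SecondCountableTopology G]
    [SimplyConnectedSpace G] [ChartedSpace V G] [Group G] [LieGroup 𝓘(ℝ, V) ∞ G]
    [MeasurableSpace G] [BorelSpace G]
    (S : CarnotGroup.Stratification (GroupLieAlgebra 𝓘(ℝ, V) G))
    (μ : Measure G) [μ.IsHaarMeasure]
    (A : Set G) (hA : CarnotGroup.IsMonotoneSet S μ A) :
    CarnotGroup.HasLocallyFinitePerimeter S μ A :=
  hA.hasLocallyFinitePerimeter
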